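/- For integers $n\ge 1$ let $$b_n=\frac1{n^3}\sum_{k=0}^{n-1}(3k^2+3k+1)\binom{n-1}{k}^2\binom{n+k}{k}^2 .$$ Call a real sequence $\{u_n\}$ asymptotically log-convex (respectively asymptotically log-concave) if there is an $N$ such that $u_n>0$ for all $n\ge N$ and $u_{n-1}u_{n+1}\ge u_n^2$ (respectively $u_{n-1}u_{n+1}\le u_n^2$) for all $n\ge N+1$. Theorem. (1) The sequence $\{b_n\}$ is asymptotically log-convex; moreover there is an $N\ge 1$ such that $\{b_{n+1}/b_n\}_{n\ge N}$ is strictly increasing, and $\lim_{n\to\infty} b_{n+1}/b_n=17+12\sqrt2$. (2) The sequence $\{\sqrt[n]{b_n}\}$ is asymptotically log-concave; moreover there is an $N\ge 1$ such that $\{\sqrt[n+1]{b_{n+1}}/\sqrt[n]{b_n}\}_{n\ge N}$ is strictly decreasing, and $\lim_{n\to\infty}\sqrt[n+1]{b_{n+1}}/\sqrt[n]{b_n}=1$. -/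

import Mathlib

open Filter Topology

/-- The sequence `b_n = n⁻³ ∑_{k=0}^{n-1} (3k²+3k+1) C(n-1,k)² C(n+k,k)²`, meaningful for `n ≥ 1`
(at `n = 0` the Lean value is the irrelevant default `0`). -/
noncomputable def sunB (n : ℕ) : ℝ :=
  1 / (n : ℝ) ^ 3 * ∑ k ∈ Finset.range n,
    (3 * (k : ℝ) ^ 2 + 3 * (k : ℝ) + 1) *
      ((n - 1).choose k : ℝ) ^ 2 * ((n + k).choose k : ℝ) ^ 2

/-- The `n`-th root of `b_n`. -/
noncomputable def sunBRoot (n : ℕ) : ℝ := sunB n ^ (1 / (n : ℝ))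

/-- A positive sequence with `u_{n-1} u_{n+1} ≥ u_n²` for all `n ≥ 1`. -/
def IsLogConvexSeq (u : ℕ → ℝ) : Prop :=
  (∀ n, 0 < u n) ∧ ∀ n, 1 ≤ n → u n ^ 2 ≤ u (n - 1) * u (n + 1)

/-- A positive sequence with `u_{n-1} u_{n+1} ≤ u_n²` for all `n ≥ 1`. -/
def IsLogConcaveSeq (u : ℕ → ℝ) : Prop :=
  (∀ n, 0 < u n) ∧ ∀ n, 1 ≤ n → u (n - 1) * u (n + 1) ≤ u n ^ 2

/-- Some tail `u_N, u_{N+1}, …` of the sequence is log-convex. -/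
def IsAsymptoticallyLogConvex (u : ℕ → ℝ) : Prop :=
  ∃ N : ℕ, IsLogConvexSeq fun n => u (N + n)

/-- Some tail `u_N, u_{N+1}, …` of the sequence is log-concave. -/
def IsAsymptoticallyLogConcave (u : ℕ → ℝ) : Prop :=
  ∃ N : ℕ, IsLogConcaveSeq fun n => u (N + n)

/-! Write `A_n` for the Apéry numbers, `S_n = n³ b_n` and `α = 17 + 12√2`. Everything follows from a
two-term expansion `b_{n+1}/b_n ≈ α(1 - (5/2)/n)`, in the differenced form `HasRate`: the ratios
tend to `α` and their increments are asymptotic to `(5/2)α/n²`. Positive increments give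
log-convexity.

To get there, creative telescoping yields Apéry's recurrence (`aperyNumber_recurrence`) and a
first-order recurrence for `S_n` driven by `A_n` and `A_{n-1}` (`sunSum_recurrence`). Rates pass
through algebraic operations and contractive recurrences. Apéry's recurrence is a Riccati recurrence
for `A_{n+1}/A_n`, with rate `(3/2)α`. The increments of `S_n/(n²(4n²+1))` are explicit multiples of
Apéry numbers, and summing them is an affine contraction, which leads back to `b_n`.

For the roots, put `L_n = log b_n`. The second difference of `L_n/n` is governed by `-2(n(L_{n+1} -
L_n) - L_n)`, and the bracket grows at least like a multiple of `log n`; hence log-concavity. -/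

/-- The product `C(n,k) C(n+k,k)`, whose squares sum to the Apéry numbers. -/
noncomputable def aperyTerm (n k : ℕ) : ℝ := (n.choose k : ℝ) * ((n + k).choose k : ℝ)

/-- The Apéry numbers `∑ₖ C(n,k)² C(n+k,k)²`. -/
noncomputable def aperyNumber (n : ℕ) : ℝ := ∑ k ∈ Finset.range (n + 1), aperyTerm n k ^ 2

/-! ### Apéry numbers and their recurrence -/

theorem aperyTerm_zero_right (n : ℕ) : aperyTerm n 0 = 1 := by simp [aperyTerm]

theorem aperyTerm_eq_zero {n k : ℕ} (h : n < k) : aperyTerm n k = 0 := by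
  simp [aperyTerm, Nat.choose_eq_zero_of_lt h]

theorem aperyTerm_nonneg (n k : ℕ) : 0 ≤ aperyTerm n k := by
  unfold aperyTerm; positivity

theorem choose_succ_right_mul_cast (n k : ℕ) :
    (n.choose (k + 1) : ℝ) * (k + 1) = n.choose k * (n - k) := by
  rcases le_or_gt k n with h | h
  · have := Nat.choose_succ_right_eq n k
    rw [← Nat.cast_sub h]
    exact_mod_cast this
  · rw [Nat.choose_eq_zero_of_lt h, Nat.choose_eq_zero_of_lt (h.trans (Nat.lt_succ_self k))]
    simp

theorem choose_succ_succ_mul_cast (n k : ℕ) :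
    ((n + 1).choose (k + 1) : ℝ) * (k + 1) = (n + 1) * n.choose k := by
  exact_mod_cast (Nat.add_one_mul_choose_eq n k).symm

theorem choose_succ_left_mul_cast (n k : ℕ) :
    ((n + 1).choose k : ℝ) * (n + 1 - k) = (n + 1) * n.choose k := by
  have h1 := choose_succ_right_mul_cast (n + 1) k
  have h2 := choose_succ_succ_mul_cast n k
  push_cast at h1
  linarith

theorem choose_add_succ_mul_cast (n k : ℕ) :
    ((n + 1 + k).choose k : ℝ) * (n + 1) = (n + 1 + k) * (n + k).choose k := by
  have h := choose_succ_left_mul_cast (n + k) k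
  rw [show n + 1 + k = n + k + 1 by omega]
  push_cast at h
  linear_combination h

theorem aperyTerm_succ_right (n k : ℕ) :
    aperyTerm n (k + 1) * (k + 1) ^ 2 = aperyTerm n k * ((n - k) * (n + k + 1)) := by
  have h1 := choose_succ_right_mul_cast n k
  have h2 := choose_succ_succ_mul_cast (n + k) k
  push_cast at h2
  unfold aperyTerm
  rw [← add_assoc n k 1]
  linear_combination (↑((n + k + 1).choose (k + 1)) * (k + 1 : ℝ)) * h1 +
    (n.choose k : ℝ) * (n - k) * h2

theorem aperyTerm_succ_left (n k : ℕ) :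
    aperyTerm (n + 1) k * (n + 1 - k) = aperyTerm n k * (n + 1 + k) := by
  have h1 := choose_succ_left_mul_cast n k
  have h2 := choose_add_succ_mul_cast n k
  unfold aperyTerm
  linear_combination ((n + 1 + k).choose k : ℝ) * h1 + (n.choose k : ℝ) * h2

theorem aperyTerm_succ_succ (n k : ℕ) :
    aperyTerm (n + 1) (k + 1) * (k + 1) ^ 2 =
      aperyTerm n k * ((n + k + 2) * (n + k + 1)) := by
  have h1 := aperyTerm_succ_right (n + 1) k
  have h2 := aperyTerm_succ_left n k
  push_cast at h1
  linear_combination h1 + (n + k + 2 : ℝ) * h2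

/-- Lets row `n` be rewritten through row `n + 1`, the row carrying the telescoping certificates;
the division-free form stays valid at `k = n + 1`. -/
theorem aperyTerm_pred_left (n k : ℕ) :
    aperyTerm n (k + 1) * (k + 1) ^ 2 = aperyTerm (n + 1) k * ((n - k) * (n + 1 - k)) := by
  have h1 := aperyTerm_succ_right n k
  have h2 := aperyTerm_succ_left n k
  linear_combination h1 - (n - k : ℝ) * h2

theorem aperyNumber_eq_sum_range {n N : ℕ} (h : n < N) :
    aperyNumber n = ∑ k ∈ Finset.range N, aperyTerm n k ^ 2 := by
  refine Finset.sum_subset (Finset.range_mono h) fun k _ hk => ?_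
  rw [aperyTerm_eq_zero (by simpa using hk)]
  norm_num

theorem aperyNumber_pos (n : ℕ) : 0 < aperyNumber n := by
  refine Finset.sum_pos' (fun k _ => sq_nonneg _) ⟨0, by simp, ?_⟩
  simp [aperyTerm_zero_right]

theorem aperyNumber_le_succ (n : ℕ) : aperyNumber n ≤ aperyNumber (n + 1) := by
  rw [aperyNumber_eq_sum_range (show n < n + 2 by omega), aperyNumber]
  refine Finset.sum_le_sum fun k _ => pow_le_pow_left₀ (aperyTerm_nonneg n k) ?_ 2
  unfold aperyTerm
  gcongr <;> omega

/-- Summation of a discrete antiderivative vanishing at the right end. -/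
theorem sum_range_eq_zero_of_telescope {f G : ℕ → ℝ} {N : ℕ} (h0 : f 0 = G 0)
    (hs : ∀ k, f (k + 1) = G (k + 1) - G k) (hN : G N = 0) :
    ∑ k ∈ Finset.range (N + 1), f k = 0 := by
  rw [Finset.sum_range_succ', h0]
  simp only [hs]
  rw [Finset.sum_range_sub, hN]
  ring

theorem aperyNumber_recurrence (m : ℕ) :
    (m + 2 : ℝ) ^ 3 * aperyNumber (m + 2) =
      (34 * (m + 1 : ℝ) ^ 3 + 51 * (m + 1) ^ 2 + 27 * (m + 1) + 5) * aperyNumber (m + 1) -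
        (m + 1 : ℝ) ^ 3 * aperyNumber m := by
  have key := sum_range_eq_zero_of_telescope (N := m + 3)
    (f := fun k => (m + 2 : ℝ) ^ 3 * aperyTerm (m + 2) k ^ 2 -
      (34 * (m + 1 : ℝ) ^ 3 + 51 * (m + 1) ^ 2 + 27 * (m + 1) + 5) * aperyTerm (m + 1) k ^ 2 +
        (m + 1 : ℝ) ^ 3 * aperyTerm m k ^ 2)
    -- Zagier's certificate. Once every term at `k + 1` is a rational multiple of `aperyTerm (m + 1)
    -- k`, the telescoping relation is a rational-function identity.
    (G := fun k => 4 * (2 * m + 3 : ℝ) * (k * (2 * k + 1) - (2 * m + 3) ^ 2) *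
      aperyTerm (m + 1) k ^ 2)
    (by simp only [aperyTerm_zero_right]; push_cast; ring)
    (fun k => by
      have h1 := aperyTerm_succ_right (m + 1) k
      have h2 := aperyTerm_succ_succ (m + 1) k
      have h3 := aperyTerm_pred_left m k
      have hk : (k + 1 : ℝ) ^ 2 ≠ 0 := by positivity
      push_cast at h1 h2
      rw [← eq_div_iff hk] at h1 h2 h3
      simp only [h1, h2, h3]
      push_cast
      field_simp
      ring)
    (by simp [aperyTerm_eq_zero (show m + 1 < m + 3 by omega)])
  rw [aperyNumber_eq_sum_range (show m + 2 < m + 3 + 1 by omega),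
    aperyNumber_eq_sum_range (show m + 1 < m + 3 + 1 by omega),
    aperyNumber_eq_sum_range (show m < m + 3 + 1 by omega)]
  simp only [Finset.sum_add_distrib, Finset.sum_sub_distrib, ← Finset.mul_sum] at key
  linarith

/-! ### Creative telescoping for `n³ b_n` -/

/-- The sum `n³ b_n`. -/
noncomputable def sunSum (n : ℕ) : ℝ :=
  ∑ k ∈ Finset.range n, (3 * (k : ℝ) ^ 2 + 3 * (k : ℝ) + 1) *
    ((n - 1).choose k : ℝ) ^ 2 * ((n + k).choose k : ℝ) ^ 2

theorem sunB_eq (n : ℕ) : sunB n = 1 / (n : ℝ) ^ 3 * sunSum n := rfl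

theorem sunSum_pos (m : ℕ) : 0 < sunSum (m + 1) := by
  refine Finset.sum_pos' (fun k _ => by positivity) ⟨0, by simp, by simp⟩

/-- Since `C(m,k) = (m+1-k)/(m+1) · C(m+1,k)`, the summand is a rational multiple of a row `m + 1`
term. `sunSum_succ_succ_eq` expresses the next sum through the same row, so one certificate handles
both. -/
theorem sunSum_succ_eq {m N : ℕ} (h : m < N) :
    sunSum (m + 1) = ∑ k ∈ Finset.range N, (3 * (k : ℝ) ^ 2 + 3 * (k : ℝ) + 1) *
      ((m + 1 - k) / (m + 1) * aperyTerm (m + 1) k) ^ 2 := by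
  have e (k : ℕ) : ((m + 1 - k) / (m + 1) * aperyTerm (m + 1) k : ℝ) =
      m.choose k * (m + 1 + k).choose k := by
    have := choose_succ_left_mul_cast m k
    unfold aperyTerm
    field_simp
    linear_combination ((m + 1 + k).choose k : ℝ) * this
  simp only [e]
  refine (Finset.sum_congr rfl fun k _ => ?_).trans
    (Finset.sum_subset (Finset.range_mono h) fun k _ hk => ?_)
  · rw [Nat.add_sub_cancel]; ring
  · rw [Nat.choose_eq_zero_of_lt (show m < k by simpa using hk)]; simp

theorem sunSum_succ_succ_eq {m N : ℕ} (h : m + 1 < N) :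
    sunSum (m + 2) = ∑ k ∈ Finset.range N, (3 * (k : ℝ) ^ 2 + 3 * (k : ℝ) + 1) *
      ((m + 2 + k) / (m + 2) * aperyTerm (m + 1) k) ^ 2 := by
  rw [sunSum_succ_eq h]
  refine Finset.sum_congr rfl fun k _ => ?_
  have := aperyTerm_succ_left (m + 1) k
  push_cast at this ⊢
  congr 2
  field_simp
  linear_combination (m + 2 : ℝ) * this

/-- The coefficient of `A_n` in the inhomogeneous recurrence of `sunSum`. -/
noncomputable def sunCoeff (x : ℝ) : ℝ :=
  x ^ 2 * (6 + 25 * x + 59 * x ^ 2 + 117 * x ^ 3 + 102 * x ^ 4)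

/-- The coefficient of `-A_{n-1}` in the inhomogeneous recurrence of `sunSum`. -/
noncomputable def sunCoeffPred (x : ℝ) : ℝ := x ^ 3 * (5 + 13 * x + 9 * x ^ 2 + 6 * x ^ 3)

/-- The polynomial part of the telescoping certificate for `sunSum_recurrence`. -/
noncomputable def sunCertificate (x k : ℝ) : ℝ :=
  -(30 + 168 * x + 396 * x ^ 2 + 524 * x ^ 3 + 428 * x ^ 4 + 316 * x ^ 5 + 358 * x ^ 6 +
      300 * x ^ 7 + 96 * x ^ 8)
  - (90 + 504 * x + 1218 * x ^ 2 + 1680 * x ^ 3 + 1464 * x ^ 4 + 1056 * x ^ 5 + 684 * x ^ 6 +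
      216 * x ^ 7) * k
  - (90 + 504 * x + 1218 * x ^ 2 + 1680 * x ^ 3 + 1458 * x ^ 4 + 900 * x ^ 5 +
      288 * x ^ 6) * k ^ 2
  - (30 + 168 * x + 396 * x ^ 2 + 504 * x ^ 3 + 360 * x ^ 4 + 144 * x ^ 5) * k ^ 3

/-- The homogeneous part is solved by `n²(4n²+1)`, which dictates the normalisation `sunScaled`. -/
theorem sunSum_recurrence (m : ℕ) :
    6 * ((m + 1 : ℝ) ^ 2 * (4 * (m + 1) ^ 2 + 1) * sunSum (m + 2) -
        (m + 2 : ℝ) ^ 2 * (4 * (m + 2) ^ 2 + 1) * sunSum (m + 1)) =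
      sunCoeff (m + 1) * aperyNumber (m + 1) - sunCoeffPred (m + 1) * aperyNumber m := by
  have key := sum_range_eq_zero_of_telescope (N := m + 2)
    (f := fun k => 6 * (m + 1 : ℝ) ^ 2 * (4 * (m + 1) ^ 2 + 1) *
        ((3 * (k : ℝ) ^ 2 + 3 * (k : ℝ) + 1) *
          ((m + 2 + k) / (m + 2) * aperyTerm (m + 1) k) ^ 2) -
      6 * (m + 2 : ℝ) ^ 2 * (4 * (m + 2) ^ 2 + 1) *
        ((3 * (k : ℝ) ^ 2 + 3 * (k : ℝ) + 1) *
          ((m + 1 - k) / (m + 1) * aperyTerm (m + 1) k) ^ 2) -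
      sunCoeff (m + 1) * aperyTerm (m + 1) k ^ 2 +
      sunCoeffPred (m + 1) * aperyTerm m k ^ 2)
    (G := fun k => sunCertificate (m + 1) k * (m + 1 - k) ^ 2 / ((m + 1) ^ 2 * (m + 2) ^ 2) *
      aperyTerm (m + 1) k ^ 2)
    (by
      simp only [aperyTerm_zero_right, sunCoeff, sunCoeffPred, sunCertificate]
      push_cast
      field_simp
      ring)
    (fun k => by
      have h1 := aperyTerm_succ_right (m + 1) k
      have h3 := aperyTerm_pred_left m k
      have hk : (k + 1 : ℝ) ^ 2 ≠ 0 := by positivity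
      push_cast at h1
      rw [← eq_div_iff hk] at h1 h3
      simp only [h1, h3, sunCoeff, sunCoeffPred, sunCertificate]
      push_cast
      field_simp
      ring)
    (by simp [aperyTerm_eq_zero (show m + 1 < m + 2 by omega)])
  rw [aperyNumber_eq_sum_range (show m + 1 < m + 2 + 1 by omega),
    aperyNumber_eq_sum_range (show m < m + 2 + 1 by omega),
    sunSum_succ_eq (show m < m + 2 + 1 by omega),
    sunSum_succ_succ_eq (show m + 1 < m + 2 + 1 by omega)]
  simp only [Finset.sum_add_distrib, Finset.sum_sub_distrib, ← Finset.mul_sum] at key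
  linarith

/-! ### Calculus of sequences with a rate -/

/-- `f` converges to `l` and `n² (f (n+1) - f n)` converges to `d`. -/
structure HasRate (f : ℕ → ℝ) (l d : ℝ) : Prop where
  tendsto : Tendsto f atTop (𝓝 l)
  tendsto_diff : Tendsto (fun n : ℕ => (n : ℝ) ^ 2 * (f (n + 1) - f n)) atTop (𝓝 d)

theorem tendsto_natCast_add_div_natCast_add (a b : ℝ) :
    Tendsto (fun n : ℕ => ((n : ℝ) + a) / (n + b)) atTop (𝓝 1) := by
  have h : Tendsto (fun n : ℕ => (n : ℝ) + b) atTop atTop :=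
    tendsto_atTop_add_const_right _ _ tendsto_natCast_atTop_atTop
  have h2 : Tendsto (fun n : ℕ => 1 + (a - b) * ((n : ℝ) + b)⁻¹) atTop (𝓝 (1 + (a - b) * 0)) :=
    (h.inv_tendsto_atTop.const_mul _).const_add _
  rw [mul_zero, add_zero] at h2
  refine h2.congr' ?_
  filter_upwards [h.eventually_gt_atTop 0] with n hn
  field_simp
  ring

namespace HasRate

variable {f g : ℕ → ℝ} {l d l' d' : ℝ}

theorem congr' (hf : HasRate f l d) (h : f =ᶠ[atTop] g) : HasRate g l d := by
  refine ⟨hf.tendsto.congr' h, hf.tendsto_diff.congr' ?_⟩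
  filter_upwards [h, (tendsto_add_atTop_nat 1).eventually h] with n h1 h2
  rw [h1, h2]

theorem congr (hf : HasRate f l d) (h : ∀ n, f n = g n) : HasRate g l d :=
  hf.congr' (Eventually.of_forall h)

theorem const (c : ℝ) : HasRate (fun _ => c) c 0 :=
  ⟨tendsto_const_nhds, by simp⟩

theorem add (hf : HasRate f l d) (hg : HasRate g l' d') :
    HasRate (fun n => f n + g n) (l + l') (d + d') :=
  ⟨hf.tendsto.add hg.tendsto,
    (hf.tendsto_diff.add hg.tendsto_diff).congr fun n => by ring⟩

theorem mul (hf : HasRate f l d) (hg : HasRate g l' d') :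
    HasRate (fun n => f n * g n) (l * l') (d * l' + l * d') :=
  ⟨hf.tendsto.mul hg.tendsto,
    ((hf.tendsto_diff.mul ((tendsto_add_atTop_iff_nat 1).2 hg.tendsto)).add
      (hf.tendsto.mul hg.tendsto_diff)).congr fun n => by ring⟩

theorem const_mul (c : ℝ) (hf : HasRate f l d) : HasRate (fun n => c * f n) (c * l) (c * d) := by
  simpa using (const c).mul hf

theorem sub (hf : HasRate f l d) (hg : HasRate g l' d') :
    HasRate (fun n => f n - g n) (l - l') (d - d') :=
  ⟨hf.tendsto.sub hg.tendsto,
    (hf.tendsto_diff.sub hg.tendsto_diff).congr fun n => by ring⟩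

/-- Strict differentiability is what controls `φ (f (n+1)) - φ (f n)`, where both points move: the
error is `o(f (n+1) - f n)`, hence `o(1/n²)`. -/
theorem comp {φ : ℝ → ℝ} {c : ℝ} (hφ : HasStrictDerivAt φ c l) (hf : HasRate f l d) :
    HasRate (fun n => φ (f n)) (φ l) (c * d) := by
  have hf1 := (tendsto_add_atTop_iff_nat 1).2 hf.tendsto
  refine ⟨hφ.hasDerivAt.continuousAt.tendsto.comp hf.tendsto, ?_⟩
  have h1 := hφ.hasStrictFDerivAt.isLittleO.comp_tendsto (hf1.prodMk_nhds hf.tendsto)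
  have h2 := (Asymptotics.isBigO_refl (fun n : ℕ => (n : ℝ) ^ 2) atTop).mul_isLittleO h1
  have h3 := (h2.trans_isBigO (hf.tendsto_diff.isBigO_one ℝ)).tendsto_div_nhds_zero
  have h4 := h3.add (hf.tendsto_diff.const_mul c)
  rw [zero_add] at h4
  refine h4.congr fun n => ?_
  simp
  ring

theorem inv (hf : HasRate f l d) (hl : l ≠ 0) : HasRate (fun n => (f n)⁻¹) l⁻¹ (-d / l ^ 2) := by
  have h := hf.comp (hasStrictDerivAt_inv hl)
  rwa [show -(l ^ 2)⁻¹ * d = -d / l ^ 2 by ring] at h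

theorem log (hf : HasRate f l d) (hl : l ≠ 0) :
    HasRate (fun n => Real.log (f n)) (Real.log l) (d / l) := by
  have h := hf.comp (Real.hasStrictDerivAt_log hl)
  rwa [inv_mul_eq_div] at h

theorem eventually_lt_succ (hf : HasRate f l d) (hd : 0 < d) : ∀ᶠ n in atTop, f n < f (n + 1) := by
  filter_upwards [hf.tendsto_diff.eventually_const_lt hd] with n hn
  exact sub_pos.1 (pos_of_mul_pos_right hn (sq_nonneg _))

theorem div (hf : HasRate f l d) (hg : HasRate g l' d') (hl : l' ≠ 0) :
    HasRate (fun n => f n / g n) (l / l') ((d * l' - l * d') / l' ^ 2) := by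
  have h := hf.mul (hg.inv hl)
  have e : d * l'⁻¹ + l * (-d' / l' ^ 2) = (d * l' - l * d') / l' ^ 2 := by
    field_simp
    ring
  rw [e] at h
  exact h

theorem comp_succ (hf : HasRate f l d) : HasRate (fun n => f (n + 1)) l d := by
  refine ⟨(tendsto_add_atTop_iff_nat 1).2 hf.tendsto, ?_⟩
  have h := ((tendsto_natCast_add_div_natCast_add 0 1).pow 2).mul
    ((tendsto_add_atTop_iff_nat 1).2 hf.tendsto_diff)
  rw [one_pow, one_mul] at h
  refine h.congr fun n => ?_
  push_cast
  field_simp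
  ring

theorem of_comp_succ (hf : HasRate (fun n => f (n + 1)) l d) : HasRate f l d := by
  refine ⟨(tendsto_add_atTop_iff_nat 1).1 hf.tendsto, (tendsto_add_atTop_iff_nat 1).1 ?_⟩
  have h := ((tendsto_natCast_add_div_natCast_add 1 0).pow 2).mul hf.tendsto_diff
  rw [one_pow, one_mul] at h
  refine h.congr' ?_
  filter_upwards [eventually_gt_atTop 0] with n hn
  push_cast
  field_simp
  ring

/-- The basic building block: with the algebraic rules it gives rates to rational functions of
`1/(n+1)` whose denominators do not vanish at `0`. -/
theorem inv_natCast_succ : HasRate (fun n : ℕ => ((n : ℝ) + 1)⁻¹) 0 (-1) := by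
  refine ⟨(tendsto_atTop_add_const_right _ _ tendsto_natCast_atTop_atTop).inv_tendsto_atTop, ?_⟩
  have h := ((tendsto_natCast_add_div_natCast_add 0 1).mul
    (tendsto_natCast_add_div_natCast_add 0 2)).neg
  rw [one_mul] at h
  refine h.congr fun n => ?_
  push_cast
  field_simp
  ring

end HasRate

/-! ### Contractive recurrences -/

/-- Perturbed linear contractions with vanishing forcing term converge to zero. -/
theorem tendsto_zero_of_contraction {y a h : ℕ → ℝ} {θ : ℝ} (hθ : θ < 1)
    (hy : ∀ᶠ n in atTop, y (n + 1) = a n + h n * y n) (hh : ∀ᶠ n in atTop, |h n| ≤ θ)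
    (ha : Tendsto a atTop (𝓝 0)) : Tendsto y atTop (𝓝 0) := by
  have hθ0 : 0 ≤ θ := by
    obtain ⟨n, hn⟩ := hh.exists
    exact (abs_nonneg _).trans hn
  rw [Metric.tendsto_atTop]
  intro ε hε
  -- With this forcing bound, `ε/2` is the fixed point of `t ↦ ε/2 * (1 - θ) + θ * t`.
  have hδ : 0 < ε / 2 * (1 - θ) := mul_pos (half_pos hε) (sub_pos.2 hθ)
  obtain ⟨N, hN⟩ := eventually_atTop.1
    ((hy.and hh).and (ha.abs.eventually_lt_const (by simpa using hδ)))
  have bound (j : ℕ) : |y (N + j)| ≤ ε / 2 + θ ^ j * |y N| := by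
    induction j with
    | zero => simpa using (half_pos hε).le
    | succ j ih =>
      obtain ⟨⟨h1, h2⟩, h3⟩ := hN (N + j) (by omega)
      rw [← add_assoc, h1]
      calc |a (N + j) + h (N + j) * y (N + j)|
          ≤ |a (N + j)| + |h (N + j)| * |y (N + j)| := by
            rw [← abs_mul]; exact abs_add_le _ _
        _ ≤ ε / 2 * (1 - θ) + θ * (ε / 2 + θ ^ j * |y N|) := by gcongr
        _ = ε / 2 + θ ^ (j + 1) * |y N| := by ring
  have ht : Tendsto (fun j : ℕ => θ ^ j * |y N|) atTop (𝓝 0) := by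
    simpa using (tendsto_pow_atTop_nhds_zero_of_lt_one hθ0 hθ).mul_const |y N|
  obtain ⟨J, hJ⟩ := eventually_atTop.1 (ht.eventually_lt_const (half_pos hε))
  refine ⟨N + J, fun n hn => ?_⟩
  obtain ⟨j, rfl⟩ := Nat.exists_eq_add_of_le (show N ≤ n by omega)
  rw [Real.dist_eq, sub_zero]
  linarith [bound j, hJ j (by omega)]

theorem tendsto_of_contraction {y a h : ℕ → ℝ} {a₀ h₀ : ℝ} (h1 : |h₀| < 1)
    (hy : ∀ᶠ n in atTop, y (n + 1) = a n + h n * y n)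
    (ha : Tendsto a atTop (𝓝 a₀)) (hh : Tendsto h atTop (𝓝 h₀)) :
    Tendsto y atTop (𝓝 (a₀ / (1 - h₀))) := by
  have hne : 1 - h₀ ≠ 0 := by
    have := (abs_lt.1 h1).2
    linarith
  obtain ⟨θ, hθ, hθ1⟩ := exists_between h1
  have key : Tendsto (fun n => y n - a₀ / (1 - h₀)) atTop (𝓝 0) := by
    refine tendsto_zero_of_contraction (a := fun n => a n + h n * (a₀ / (1 - h₀)) - a₀ / (1 - h₀))
      (h := h) hθ1 ?_ ((hh.abs.eventually_lt_const hθ).mono fun n hn => hn.le) ?_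
    · filter_upwards [hy] with n hn
      rw [hn]
      ring
    · have := (ha.add (hh.mul_const (a₀ / (1 - h₀)))).sub_const (a₀ / (1 - h₀))
      convert this using 2
      field_simp
      ring
  simpa using key.add_const (a₀ / (1 - h₀))

/-- If the differences of a convergent sequence satisfy a contractive linear recurrence whose
forcing term is `~ g₀ / n²`, then the sequence has a rate. -/
theorem HasRate.of_diff_contraction {y g h : ℕ → ℝ} {l g₀ h₀ : ℝ} (hl : Tendsto y atTop (𝓝 l))
    (hy : ∀ᶠ n in atTop, y (n + 2) - y (n + 1) = g n + h n * (y (n + 1) - y n))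
    (hg : Tendsto (fun n : ℕ => (n : ℝ) ^ 2 * g n) atTop (𝓝 g₀)) (hh : Tendsto h atTop (𝓝 h₀))
    (h1 : |h₀| < 1) : HasRate y l (g₀ / (1 - h₀)) := by
  have e := (tendsto_natCast_add_div_natCast_add 1 0).pow 2
  rw [one_pow] at e
  -- The scaled differences `n² (y (n+1) - y n)` satisfy the same recurrence with forcing `n² g n`,
  -- both coefficients multiplied by `((n+1)/n)² → 1`.
  refine ⟨hl, tendsto_of_contraction h1 ?_ (by simpa using e.mul hg) (by simpa using e.mul hh)⟩
  filter_upwards [hy, eventually_gt_atTop 0] with n hn h0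
  rw [show n + 1 + 1 = n + 2 from rfl, hn]
  push_cast
  field_simp

/-- Rates for sequences defined by a contractive affine recurrence. -/
theorem HasRate.of_affine_recurrence {y p q : ℕ → ℝ} {p₀ p₁ q₀ q₁ : ℝ}
    (hp : HasRate p p₀ p₁) (hq : HasRate q q₀ q₁) (h1 : |q₀| < 1)
    (hy : ∀ᶠ n in atTop, y (n + 1) = p n + q n * y n) :
    HasRate y (p₀ / (1 - q₀)) ((p₁ + q₁ * (p₀ / (1 - q₀))) / (1 - q₀)) := by
  have hl := tendsto_of_contraction h1 hy hp.tendsto hq.tendsto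
  refine HasRate.of_diff_contraction hl
    (g := fun n => (p (n + 1) - p n) + (q (n + 1) - q n) * y (n + 1)) (h := q) ?_ ?_ hq.tendsto h1
  · filter_upwards [hy, (tendsto_add_atTop_nat 1).eventually hy] with n h2 h3
    rw [show n + 2 = n + 1 + 1 from rfl, h3]
    linear_combination -h2
  · exact (hp.tendsto_diff.add (hq.tendsto_diff.mul
      ((tendsto_add_atTop_iff_nat 1).2 hl))).congr fun n => by ring

/-- Rates for sequences defined by a contractive Riccati recurrence. -/
theorem HasRate.of_riccati_recurrence {y p q : ℕ → ℝ} {p₀ p₁ q₀ q₁ l : ℝ}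
    (hp : HasRate p p₀ p₁) (hq : HasRate q q₀ q₁) (hl : |q₀| < l) (hlq : |q₀| < l ^ 2)
    (hfix : l = p₀ - q₀ / l) (hy1 : ∀ᶠ n in atTop, 1 ≤ y n)
    (hy : ∀ᶠ n in atTop, y (n + 1) = p n - q n / y n) :
    HasRate y l ((p₁ - q₁ / l) / (1 - q₀ / l ^ 2)) := by
  have hl0 : 0 < l := (abs_nonneg _).trans_lt hl
  have hlim : Tendsto y atTop (𝓝 l) := by
    obtain ⟨θ, hθ, hθ1⟩ := exists_between ((div_lt_one hl0).2 hl)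
    have key : Tendsto (fun n => y n - l) atTop (𝓝 0) := by
      -- Subtracting the fixed point leaves the factor `q n / (l * y n)` on `y n - l`; since `y n ≥
      -- 1`, it is at most `|q n| / l`, which is eventually below `θ < 1`.
      refine tendsto_zero_of_contraction (a := fun n => p n - q n / l - l)
        (h := fun n => q n / (l * y n)) hθ1 ?_ ?_ ?_
      · filter_upwards [hy, hy1] with n h2 h3
        have : y n ≠ 0 := by positivity
        rw [h2]
        field_simp
        ring
      · filter_upwards [hy1, (hq.tendsto.abs.div_const l).eventually_lt_const hθ] with n h2 h3
        rw [abs_div, abs_mul, abs_of_pos hl0, abs_of_pos (by linarith : 0 < y n)]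
        refine le_trans ?_ h3.le
        gcongr
        nlinarith
      · have := (hp.tendsto.sub (hq.tendsto.div_const l)).sub_const l
        rwa [← hfix, sub_self] at this
    simpa using key.add_const l
  have hlim1 := (tendsto_add_atTop_iff_nat 1).2 hlim
  refine HasRate.of_diff_contraction hlim
    (g := fun n => (p (n + 1) - p n) - (q (n + 1) - q n) / y (n + 1))
    (h := fun n => q n / (y n * y (n + 1))) ?_ ?_ ?_ ?_
  · filter_upwards [hy, (tendsto_add_atTop_nat 1).eventually hy, hy1,
      (tendsto_add_atTop_nat 1).eventually hy1] with n h2 h3 h4 h5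
    rw [show n + 2 = n + 1 + 1 from rfl, h3]
    have e4 : y n ≠ 0 := by positivity
    have e5 : y (n + 1) ≠ 0 := by positivity
    have e6 : y (n + 1) - p n = - (q n / y n) := by linarith
    have e7 : p (n + 1) - q (n + 1) / y (n + 1) - y (n + 1) =
        p (n + 1) - p n - q (n + 1) / y (n + 1) - (y (n + 1) - p n) := by ring
    rw [e7, e6]
    field_simp
    ring
  · exact (hp.tendsto_diff.sub (hq.tendsto_diff.div hlim1 hl0.ne')).congr fun n => by
      simp only [Pi.div_apply]; ring
  · rw [sq]
    exact hq.tendsto.div (hlim.mul hlim1) (mul_ne_zero hl0.ne' hl0.ne')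
  · rw [abs_div, abs_of_pos (pow_pos hl0 2)]
    exact (div_lt_one (pow_pos hl0 2)).2 hlq

/-! ### From ratio rates to monotonicity of ratios and roots -/

theorem strictMonoOn_Ici_of_lt_succ {f : ℕ → ℝ} {N : ℕ} (h : ∀ n, N ≤ n → f n < f (n + 1)) :
    StrictMonoOn f (Set.Ici N) :=
  strictMonoOn_of_lt_succ Set.ordConnected_Ici fun n _ hn _ => h n hn

theorem strictAntiOn_Ici_of_succ_lt {f : ℕ → ℝ} {N : ℕ} (h : ∀ n, N ≤ n → f (n + 1) < f n) :
    StrictAntiOn f (Set.Ici N) :=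
  strictAntiOn_of_succ_lt Set.ordConnected_Ici fun n _ hn _ => h n hn

/-- If `n² (L (n+2) - 2 L (n+1) + L n)` has a positive limit, then `n (L (n+1) - L n) - L n`
tends to infinity. -/
theorem HasRate.tendsto_mul_diff_sub_atTop {L : ℕ → ℝ} {l d : ℝ}
    (hL : HasRate (fun n => L (n + 1) - L n) l d) (hd : 0 < d) :
    Tendsto (fun n : ℕ => n * (L (n + 1) - L n) - L n) atTop atTop := by
  obtain ⟨N, hN⟩ := eventually_atTop.1 ((hL.tendsto_diff.eventually_const_lt (half_lt_self hd)).and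
    (eventually_gt_atTop 0))
  -- The increment of `n (L (n+1) - L n) - L n` is exactly `(n+1)` times the second difference of
  -- `L`, so at least `d/(2n)`, which dominates the increment of `(d/2) log n`.
  have step (n : ℕ) (hn : N ≤ n) : d / 2 * (Real.log (n + 1 : ℕ) - Real.log n) ≤
      ((n + 1 : ℕ) * (L (n + 2) - L (n + 1)) - L (n + 1)) - (n * (L (n + 1) - L n) - L n) := by
    obtain ⟨h1, h2⟩ := hN n hn
    have hn0 : (0 : ℝ) < n := by exact_mod_cast h2
    have h3 : Real.log (n + 1 : ℕ) - Real.log n ≤ 1 / n := by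
      rw [← Real.log_div (by positivity) (by positivity)]
      refine (Real.log_le_sub_one_of_pos (by positivity)).trans_eq ?_
      push_cast
      field_simp
      ring
    have h4 : d / 2 * (1 / n) ≤ n * (L (n + 2) - L (n + 1) - (L (n + 1) - L n)) := by
      rw [mul_one_div, div_le_iff₀ hn0]
      refine h1.le.trans_eq ?_
      ring
    have h5 : 0 ≤ L (n + 2) - L (n + 1) - (L (n + 1) - L n) :=
      (pos_of_mul_pos_right ((half_pos hd).trans h1) (sq_nonneg _)).le
    have h6 := mul_le_mul_of_nonneg_left h3 (half_pos hd).le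
    push_cast at h6 ⊢
    linarith
  have bound (n : ℕ) (hn : N ≤ n) : (N * (L (N + 1) - L N) - L N - d / 2 * Real.log N) +
      d / 2 * Real.log n ≤ n * (L (n + 1) - L n) - L n := by
    induction n, hn using Nat.le_induction with
    | base => linarith
    | succ n hn ih =>
      have := step n hn
      rw [show n + 1 + 1 = n + 2 from rfl]
      linarith
  refine tendsto_atTop_mono' _ ((eventually_ge_atTop N).mono bound) ?_
  exact tendsto_atTop_add_const_left _ _ ((Real.tendsto_log_atTop.comp
    tendsto_natCast_atTop_atTop).const_mul_atTop (half_pos hd))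

/-- Multiplied by `n(n+1)(n+2)`, the second difference of `L n / n` becomes `n(n+1)` times that of
`L`, which stays bounded, minus `2(n (L (n+1) - L n) - L n)`, which tends to infinity. -/
theorem HasRate.eventually_second_diff_div_neg {L : ℕ → ℝ} {l d : ℝ}
    (hL : HasRate (fun n => L (n + 1) - L n) l d) (hd : 0 < d) :
    ∀ᶠ n : ℕ in atTop, L (n + 2) / (n + 2 : ℕ) - L (n + 1) / (n + 1 : ℕ) <
      L (n + 1) / (n + 1 : ℕ) - L n / n := by
  filter_upwards [hL.tendsto_diff.eventually_lt_const (lt_add_one d),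
    hL.tendsto_diff.eventually_const_lt hd,
    (hL.tendsto_mul_diff_sub_atTop hd).eventually_gt_atTop (d + 1), eventually_gt_atTop 0]
    with n h1 h1' h2 h3
  have hn : (1 : ℝ) ≤ n := by exact_mod_cast h3
  have e : L (n + 2) / (n + 2 : ℕ) - L (n + 1) / (n + 1 : ℕ) - (L (n + 1) / (n + 1 : ℕ) - L n / n) =
      (n * (n + 1) * (L (n + 2) - L (n + 1) - (L (n + 1) - L n)) -
        2 * (n * (L (n + 1) - L n) - L n)) / (n * (n + 1) * (n + 2)) := by
    push_cast
    field_simp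
    ring
  rw [← sub_neg, e]
  refine div_neg_of_neg_of_pos ?_ (by positivity)
  have h4 : 0 < L (n + 2) - L (n + 1) - (L (n + 1) - L n) :=
    pos_of_mul_pos_right h1' (sq_nonneg _)
  have h5 : (n : ℝ) * (n + 1) * (L (n + 2) - L (n + 1) - (L (n + 1) - L n)) ≤
      2 * (n ^ 2 * (L (n + 2) - L (n + 1) - (L (n + 1) - L n))) := by
    have : (n : ℝ) * (n + 1) ≤ 2 * n ^ 2 := by nlinarith
    nlinarith
  have h6 : (n : ℝ) ^ 2 * (L (n + 2) - L (n + 1) - (L (n + 1) - L n)) < d + 1 := h1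
  linarith

/-- Cesàro averaging of the increments gives `L n / n → l`, so consecutive terms become close. -/
theorem tendsto_div_sub_div_zero {L : ℕ → ℝ} {l : ℝ}
    (hL : Tendsto (fun n => L (n + 1) - L n) atTop (𝓝 l)) :
    Tendsto (fun n : ℕ => L (n + 1) / (n + 1 : ℕ) - L n / n) atTop (𝓝 0) := by
  have h : Tendsto (fun n : ℕ => L n / n) atTop (𝓝 l) := by
    have h1 := hL.cesaro.add (tendsto_inv_atTop_nhds_zero_nat.const_mul (L 0))
    rw [mul_zero, add_zero] at h1
    refine h1.congr fun n => ?_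
    rw [Finset.sum_range_sub]
    ring
  simpa using ((tendsto_add_atTop_iff_nat 1).2 h).sub h

/-- Ratio and root asymptotics, with monotonicity, of a sequence whose ratios have a positive
rate. -/
theorem ratio_root_monotonicity {b c : ℕ → ℝ} {l d : ℝ} (hb : ∀ n, 1 ≤ n → 0 < b n)
    (hc : ∀ n, c n = b n ^ (1 / (n : ℝ))) (hl : 0 < l) (hd : 0 < d)
    (hr : HasRate (fun n => b (n + 1) / b n) l d) :
    (IsAsymptoticallyLogConvex b ∧
      (∃ N : ℕ, 1 ≤ N ∧ StrictMonoOn (fun n : ℕ => b (n + 1) / b n) (Set.Ici N)) ∧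
      Tendsto (fun n : ℕ => b (n + 1) / b n) atTop (𝓝 l)) ∧
    (IsAsymptoticallyLogConcave c ∧
      (∃ N : ℕ, 1 ≤ N ∧ StrictAntiOn (fun n : ℕ => c (n + 1) / c n) (Set.Ici N)) ∧
      Tendsto (fun n : ℕ => c (n + 1) / c n) atTop (𝓝 1)) := by
  have hL : HasRate (fun n => Real.log (b (n + 1)) - Real.log (b n)) (Real.log l) (d / l) := by
    refine (hr.log hl.ne').congr' ?_
    filter_upwards [eventually_ge_atTop 1] with n hn
    rw [Real.log_div (hb _ (by omega)).ne' (hb n hn).ne']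
  have hcpos (n : ℕ) (hn : 1 ≤ n) : 0 < c n := by
    rw [hc]
    exact Real.rpow_pos_of_pos (hb n hn) _
  have hcratio (n : ℕ) (hn : 1 ≤ n) : c (n + 1) / c n =
      Real.exp (Real.log (b (n + 1)) / (n + 1 : ℕ) - Real.log (b n) / n) := by
    rw [hc, hc, Real.rpow_def_of_pos (hb _ (by omega)), Real.rpow_def_of_pos (hb n hn),
      ← Real.exp_sub, mul_one_div, mul_one_div]
  -- The thresholds are kept at least `1` because nothing is assumed about `b 0`.
  obtain ⟨N₁, h1⟩ := eventually_atTop.1 ((hr.eventually_lt_succ hd).and (eventually_ge_atTop 1))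
  obtain ⟨N₂, h2⟩ := eventually_atTop.1
    ((HasRate.eventually_second_diff_div_neg (L := fun n => Real.log (b n)) hL
      (div_pos hd hl)).and (eventually_ge_atTop 1))
  have hclt (n : ℕ) (hn : N₂ ≤ n) : c (n + 2) / c (n + 1) < c (n + 1) / c n := by
    rw [hcratio n (h2 n hn).2, show n + 2 = n + 1 + 1 from rfl, hcratio (n + 1) (by omega)]
    exact Real.exp_lt_exp.2 (h2 n hn).1
  refine ⟨⟨⟨N₁, fun n => hb _ ((h1 _ le_rfl).2.trans (by omega)), fun n hn => ?_⟩,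
    ⟨N₁, (h1 _ le_rfl).2, strictMonoOn_Ici_of_lt_succ fun n hn => (h1 n hn).1⟩, hr.tendsto⟩,
    ⟨N₂, fun n => hcpos _ ((h2 _ le_rfl).2.trans (by omega)), fun n hn => ?_⟩,
    ⟨N₂, (h2 _ le_rfl).2, strictAntiOn_Ici_of_succ_lt hclt⟩, ?_⟩
  · obtain ⟨j, rfl⟩ := Nat.exists_eq_add_of_le' hn
    obtain ⟨h3, h4⟩ := h1 (N₁ + j) (by omega)
    have h5 := (div_lt_div_iff₀ (hb _ h4) (hb (N₁ + j + 1) (by omega))).1 h3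
    simp only [Nat.add_sub_cancel]
    rw [sq, mul_comm (b (N₁ + j))]
    exact h5.le
  · obtain ⟨j, rfl⟩ := Nat.exists_eq_add_of_le' hn
    have h3 := hclt (N₂ + j) (by omega)
    have h4 := (h2 (N₂ + j) (by omega)).2
    have h5 := (div_lt_div_iff₀ (hcpos (N₂ + j + 1) (by omega)) (hcpos _ h4)).1 h3
    simp only [Nat.add_sub_cancel]
    rw [sq, mul_comm (c (N₂ + j))]
    exact h5.le
  · have h3 := (Real.continuous_exp.tendsto 0).comp 
      (tendsto_div_sub_div_zero (L := fun n => Real.log (b n)) hL.tendsto)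
    rw [Real.exp_zero] at h3
    refine h3.congr' ?_
    filter_upwards [eventually_ge_atTop 1] with n hn
    exact (hcratio n hn).symm

/-! ### Rates for the Apéry numbers and for `b_n` -/

/-- The larger root `17 + 12√2` of `x² - 34 x + 1`. -/
noncomputable def aperyRoot : ℝ := 17 + 12 * Real.sqrt 2

theorem aperyRoot_sq : aperyRoot ^ 2 = 34 * aperyRoot - 1 := by
  have h : Real.sqrt 2 ^ 2 = 2 := Real.sq_sqrt (by norm_num)
  unfold aperyRoot
  linear_combination 144 * h

theorem seventeen_lt_aperyRoot : 17 < aperyRoot := by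
  have : 0 < Real.sqrt 2 := by positivity
  unfold aperyRoot
  linarith

/-- With `z = 1/(n+1)`, Apéry's recurrence reads `y_{n+1} = p - q/y_n`, where `p = (34 + 51z + 27z²
+ 5z³)/(1+z)³` and `q = (1+z)⁻³`. Monotonicity of `A_n` keeps the ratios at least `1`, on the side
of the attracting fixed point. The rate reflects `A_n ~ C αⁿ n^(-3/2)`. -/
theorem hasRate_aperyNumber_ratio :
    HasRate (fun n => aperyNumber (n + 1) / aperyNumber n) aperyRoot (3 / 2 * aperyRoot) := by
  have hα := seventeen_lt_aperyRoot
  have hsq := aperyRoot_sq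
  have hα0 : aperyRoot ≠ 0 := by positivity
  have hz := HasRate.inv_natCast_succ
  have hz1 := (HasRate.const 1).add hz
  have hz13 := (hz1.mul hz1).mul hz1
  have hp := (((HasRate.const 34).add (hz.const_mul 51)).add (((hz.mul hz).const_mul 27).add
    (((hz.mul hz).mul hz).const_mul 5))).div hz13 (by norm_num)
  have hq := hz13.inv (by norm_num)
  have h := HasRate.of_riccati_recurrence hp hq (l := aperyRoot)
    (y := fun n => aperyNumber (n + 1) / aperyNumber n)
    (by norm_num; linarith) (by norm_num [abs_of_pos (show 0 < aperyRoot by linarith)]; linarith)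
    (by norm_num; field_simp; linarith)
    (Eventually.of_forall fun n => (one_le_div (aperyNumber_pos n)).2 (aperyNumber_le_succ n))
    (Eventually.of_forall fun n => by
      have h0 := (aperyNumber_pos n).ne'
      have h1 := (aperyNumber_pos (n + 1)).ne'
      have hx : (n + 2 : ℝ) ≠ 0 := by positivity
      have e : (1 + ((n : ℝ) + 1)⁻¹) = (n + 2) / (n + 1) := by field_simp; ring
      have hrec := eq_div_of_mul_eq (pow_ne_zero 3 hx)
        ((mul_comm _ _).trans (aperyNumber_recurrence n))
      rw [show n + 1 + 1 = n + 2 from rfl, hrec, e]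
      field_simp
      ring)
  convert h using 1
  have h2 : aperyRoot ^ 2 - 1 ≠ 0 := by nlinarith
  norm_num
  field_simp
  linear_combination 3 * hsq

/-- The normalisation of `sunSum` whose differences are multiples of Apéry numbers. -/
noncomputable def sunScaled (m : ℕ) : ℝ :=
  sunSum (m + 1) / ((m + 1 : ℝ) ^ 2 * (4 * (m + 1) ^ 2 + 1))

/-- The ratio `(m+1)² (sunScaled (m+1) - sunScaled m) / A_m`, as a function of `a = A_{m+1} / A_m`
and `z = 1 / (m+1)`. -/
noncomputable def sunFactor (a z : ℝ) : ℝ :=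
  ((102 + 117 * z + 59 * z ^ 2 + 25 * z ^ 3 + 6 * z ^ 4) * a -
    (6 + 9 * z + 13 * z ^ 2 + 5 * z ^ 3)) /
  (6 * ((4 + z ^ 2) * ((1 + z) ^ 2 * (4 * (1 + z) ^ 2 + z ^ 2))))

theorem sunScaled_pos (m : ℕ) : 0 < sunScaled m := by
  have := sunSum_pos m
  unfold sunScaled
  positivity

theorem sunScaled_succ_sub (m : ℕ) : sunScaled (m + 1) - sunScaled m =
    aperyNumber m * (sunFactor (aperyNumber (m + 1) / aperyNumber m) ((m : ℝ) + 1)⁻¹ *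
      (((m : ℝ) + 1)⁻¹) ^ 2) := by
  have hA := (aperyNumber_pos m).ne'
  have hx : (m + 1 : ℝ) ≠ 0 := by positivity
  have e1 : sunScaled (m + 1) - sunScaled m =
      (sunCoeff (m + 1) * aperyNumber (m + 1) - sunCoeffPred (m + 1) * aperyNumber m) /
        (6 * ((m + 1 : ℝ) ^ 2 * (4 * (m + 1) ^ 2 + 1) *
          ((m + 2 : ℝ) ^ 2 * (4 * (m + 2) ^ 2 + 1)))) := by
    rw [← sunSum_recurrence]
    unfold sunScaled
    push_cast
    rw [show (m + 1 + 1 : ℝ) = m + 2 by ring, show m + 1 + 1 = m + 2 from rfl]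
    field_simp
  have e2 : (1 + ((m : ℝ) + 1)⁻¹) = (m + 2) / (m + 1) := by field_simp; ring
  have e3 : (4 + (((m : ℝ) + 1)⁻¹) ^ 2) = (4 * (m + 1) ^ 2 + 1) / (m + 1) ^ 2 := by field_simp
  have e4 : (4 * ((m + 2 : ℝ) / (m + 1)) ^ 2 + (((m : ℝ) + 1)⁻¹) ^ 2) =
      (4 * (m + 2) ^ 2 + 1) / (m + 1) ^ 2 := by field_simp
  rw [e1, sunFactor, e2, e3, e4, sunCoeff, sunCoeffPred]
  field_simp
  ring

/-- The values of `l` and `d` are irrelevant: the quotient of consecutive factors has limit `1` and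
rate `0` as soon as `l ≠ 0`. -/
theorem exists_hasRate_sunFactor : ∃ l d, l ≠ 0 ∧ HasRate
    (fun m => sunFactor (aperyNumber (m + 1) / aperyNumber m) ((m : ℝ) + 1)⁻¹) l d := by
  have hz := HasRate.inv_natCast_succ
  have hz1 := (HasRate.const 1).add hz
  have hz2 := hz.mul hz
  have hz12 := hz1.mul hz1
  have hz3 := hz2.mul hz
  have hnum := (((((HasRate.const 102).add (hz.const_mul 117)).add ((hz2.const_mul 59).add
    (hz3.const_mul 25))).add ((hz2.mul hz2).const_mul 6)).mul hasRate_aperyNumber_ratio).sub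
    (((HasRate.const 6).add (hz.const_mul 9)).add ((hz2.const_mul 13).add (hz3.const_mul 5)))
  have hden := (((HasRate.const 4).add hz2).mul (hz12.mul ((hz12.const_mul 4).add hz2))).const_mul 6
  refine ⟨_, _, ?_, (hnum.div hden (by norm_num)).congr fun m => ?_⟩
  · have := seventeen_lt_aperyRoot
    apply ne_of_gt
    norm_num
    linarith
  · unfold sunFactor
    congr 1 <;> ring

/-- The Apéry ratio contributes `(3/2)α`, the factor `((m+1)/(m+2))²` contributes `2α`, and the
`sunFactor` quotient nothing. -/
theorem hasRate_sunScaled_diff_ratio : HasRate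
    (fun m => (sunScaled (m + 2) - sunScaled (m + 1)) / (sunScaled (m + 1) - sunScaled m))
    aperyRoot (7 / 2 * aperyRoot) := by
  obtain ⟨l, d, hv0, hv⟩ := exists_hasRate_sunFactor
  have hz := HasRate.inv_natCast_succ
  have hw := ((HasRate.const 1).add hz).inv (by norm_num)
  have h := (hasRate_aperyNumber_ratio.mul (hv.comp_succ.div hv hv0)).mul (hw.mul hw)
  convert h.congr' ?_ using 1
  · field_simp
    norm_num
  · field_simp
    ring
  · filter_upwards [hv.tendsto.eventually_ne hv0] with m hm
    have hA := (aperyNumber_pos m).ne'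
    have e : (1 + ((m : ℝ) + 1)⁻¹) = (m + 2) / (m + 1) := by field_simp; ring
    have hs := sunScaled_succ_sub (m + 1)
    rw [show m + 1 + 1 = m + 2 from rfl] at hs
    rw [sunScaled_succ_sub m, hs, e]
    push_cast
    field_simp
    ring

theorem hasRate_sunScaled_ratio :
    HasRate (fun m => sunScaled (m + 1) / sunScaled m) aperyRoot (7 / 2 * aperyRoot) := by
  have hα := seventeen_lt_aperyRoot
  have hα0 : aperyRoot ≠ 0 := by positivity
  have hα1 : aperyRoot - 1 ≠ 0 := by
    apply ne_of_gt
    linarith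
  have hu := hasRate_sunScaled_diff_ratio
  have hne : ∀ᶠ m in atTop, sunScaled (m + 1) - sunScaled m ≠ 0 := by
    filter_upwards [hu.tendsto.eventually_ne hα0] with m hm h0
    exact hm (by rw [h0, div_zero])
  have hs := hu.inv hα0
  -- Write `s_m` for `sunScaled m`, `Δ_m = s_{m+1} - s_m` and `r_m = Δ_m/Δ_{m+1} → 1/α < 1`. Then
  -- `x_m = s_m/Δ_m` satisfies `x_{m+1} = r_m + r_m x_m`, and the wanted ratio is `1 + 1/x_m`.
  have hx := HasRate.of_affine_recurrence hs hs
    (y := fun m => sunScaled m / (sunScaled (m + 1) - sunScaled m))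
    (by rw [abs_of_pos (by positivity)]; exact inv_lt_one_of_one_lt₀ (by linarith))
    (by
      filter_upwards [hne, (tendsto_add_atTop_nat 1).eventually hne] with m h1 h2
      rw [show m + 1 + 1 = m + 2 from rfl] at h2 ⊢
      field_simp
      ring)
  have e : 1 - aperyRoot⁻¹ = (aperyRoot - 1) / aperyRoot := by field_simp
  have hl : aperyRoot⁻¹ / (1 - aperyRoot⁻¹) = (aperyRoot - 1)⁻¹ := by
    rw [e]
    field_simp
  rw [hl] at hx
  have h := (HasRate.const 1).add (hx.inv (inv_ne_zero hα1))
  convert h.congr' ?_ using 1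
  · simp
  · rw [e]
    field_simp
    ring
  · filter_upwards [hne] with m hm
    have := (sunScaled_pos m).ne'
    field_simp
    ring

theorem hasRate_sunB_ratio :
    HasRate (fun n => sunB (n + 1) / sunB n) aperyRoot (5 / 2 * aperyRoot) := by
  refine HasRate.of_comp_succ ?_
  have hz := HasRate.inv_natCast_succ
  have hz1 := (HasRate.const 1).add hz
  -- As `b_n = sunScaled (n-1) * (4n²+1)/n`, the correcting factor is the ratio of consecutive
  -- values of `(4n²+1)/n`, with limit `1` and rate `-1`; hence `7/2 - 1 = 5/2`.
  have hw := (((hz1.mul hz1).const_mul 4).add (hz.mul hz)).div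
    (hz1.mul ((HasRate.const 4).add (hz.mul hz))) (by norm_num)
  convert (hasRate_sunScaled_ratio.mul hw).congr fun m => ?_ using 1
  · norm_num
  · norm_num
    ring
  · have hS := (sunSum_pos m).ne'
    have e1 : (1 + ((m : ℝ) + 1)⁻¹) = (m + 2) / (m + 1) := by field_simp; ring
    have e2 : (4 + ((m : ℝ) + 1)⁻¹ * ((m : ℝ) + 1)⁻¹) = (4 * (m + 1) ^ 2 + 1) / (m + 1) ^ 2 := by
      field_simp
    have e3 : (4 * ((m + 2 : ℝ) / (m + 1) * ((m + 2) / (m + 1))) +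
        ((m : ℝ) + 1)⁻¹ * ((m : ℝ) + 1)⁻¹) = (4 * (m + 2) ^ 2 + 1) / (m + 1) ^ 2 := by field_simp
    rw [e1, e2, e3, sunB_eq, sunB_eq, sunScaled, sunScaled]
    push_cast
    rw [show (m + 1 + 1 : ℝ) = m + 2 by ring]
    field_simp

theorem sunB_pos {n : ℕ} (hn : 1 ≤ n) : 0 < sunB n := by
  obtain ⟨m, rfl⟩ := Nat.exists_eq_add_of_le' hn
  rw [sunB_eq]
  have := sunSum_pos m
  positivity

theorem mainTheorem2 :
    (IsAsymptoticallyLogConvex sunB ∧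
      (∃ N : ℕ, 1 ≤ N ∧ StrictMonoOn (fun n : ℕ => sunB (n + 1) / sunB n) (Set.Ici N)) ∧
      Tendsto (fun n : ℕ => sunB (n + 1) / sunB n) atTop (𝓝 (17 + 12 * Real.sqrt 2))) ∧
    (IsAsymptoticallyLogConcave sunBRoot ∧
      (∃ N : ℕ, 1 ≤ N ∧
        StrictAntiOn (fun n : ℕ => sunBRoot (n + 1) / sunBRoot n) (Set.Ici N)) ∧
      Tendsto (fun n : ℕ => sunBRoot (n + 1) / sunBRoot n) atTop (𝓝 1)) := by
  exact ratio_root_monotonicity (l := aperyRoot) (fun _ => sunB_pos) (fun _ => rfl)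
    (by linarith [seventeen_lt_aperyRoot])
    (by linarith [seventeen_lt_aperyRoot]) hasRate_sunB_ratio
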